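/- Corollary. Let $N=\mathbb{Z}^2$ with dual lattice $M=\operatorname{Hom}(N,\mathbb{Z})\cong\mathbb{Z}^2$ (identified via the dual basis), and let $l\ge 1$ be an integer. An $l$-reflexive loop $P$ is given by a cyclic sequence $x_1,\dots,x_t\in N$ ($t\ge 1$, indices modulo $t$) of non-zero lattice points, its boundary lattice points, such that for every $i$: (1) $x_{i+1}-x_i$ is primitive; (2) $\det(x_i,x_{i+1})=\pm l$; (3) if $x_i$ is a vertex, i.e. $x_i\notin\operatorname{conv}\{x_{i-1},x_{i+1}\}$, then $x_i$ is primitive. The loop may be non-convex or self-intersecting. Let $u_i\in M$ be the primitive outer normal of the segment $[x_i,x_{i+1}]$, i.e. the unique primitive element of $M$ that is constant and positive on this segment. The boundary lattice points of the dual loop $lP^*$ are, in order, the lattice points of the successive segments $[u_i,u_{i+1}]$ (the common endpoint of consecutive segments being counted once, and segments with $u_i=u_{i+1}$ contributing no further point). The length of a loop with boundary lattice points $y_1,\dots,y_s$ (indices modulo $s$) is the signed quantity $\sum_{j=1}^{s}\det(y_j,y_{j+1})/l$ (so it is $0$ if all the $u_i$ coincide and $lP^*$ degenerates to a point). Let $w(P)$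 be the winding number around the origin of the closed polygon $x_1,x_2,\dots,x_t,x_1$, that is, $\frac1{2\pi}$ times the sum of the signed angles in $(-\pi,\pi)$ from $x_i$ to $x_{i+1}$. Then, for every $l$-reflexive loop $P$, the number $w(P)$ is an integer, and the length of $P$ plus the length of $lP^*$ equals $12\,w(P)$. -/

import Mathlib

namespace ReflexiveLoop

/-- The lattice `ℤ²`. It serves as `N`, and, through the dual basis, as `M = Hom(N, ℤ)`. -/
abbrev Lat : Type := ℤ × ℤ

/-- The pairing `⟨u, x⟩` of `u ∈ M` with `x ∈ N`. -/
def pairing (u x : Lat) : ℤ := u.1 * x.1 + u.2 * x.2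

/-- The determinant of the `2 × 2` matrix with rows `x` and `y`. -/
def det (x y : Lat) : ℤ := x.1 * y.2 - x.2 * y.1

/-- A lattice point is primitive if it is non-zero and the segment from the origin to it contains
no further lattice point, that is, if its coordinates have greatest common divisor `1`. -/
def Primitive (v : Lat) : Prop := Int.gcd v.1 v.2 = 1

/-- The inclusion of the lattice in `N_ℚ = ℚ²`. -/
def toRat (x : Lat) : ℚ × ℚ := ((x.1 : ℚ), (x.2 : ℚ))

/-- The point with number `i` (counted from `0`) of the finite sequence `xs`, with the indices
read cyclically. (For the empty sequence the value is irrelevant.) -/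
def cyc (xs : List Lat) (i : ℕ) : Lat := xs.getD (i % xs.length) 0

/-- The cyclic sequence `xs` of lattice points is the sequence of boundary lattice points of an
`l`-reflexive loop. Indices are cyclic, so the last condition speaks about every point of `xs`. -/
structure IsReflexiveLoop (l : ℕ) (xs : List Lat) : Prop where
  index_pos : 0 < l
  nonempty : xs ≠ []
  ne_zero : ∀ i, cyc xs i ≠ 0
  primitive_step : ∀ i, Primitive (cyc xs (i + 1) - cyc xs i)
  det_eq : ∀ i, det (cyc xs i) (cyc xs (i + 1)) = l ∨ det (cyc xs i) (cyc xs (i + 1)) = -l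
  primitive_vertex : ∀ i,
    toRat (cyc xs (i + 1)) ∉ segment ℚ (toRat (cyc xs i)) (toRat (cyc xs (i + 2))) →
      Primitive (cyc xs (i + 1))

/-- The (signed) length `∑ det(xᵢ, xᵢ₊₁) / l` of a loop with boundary lattice points `xs`. -/
def length (l : ℕ) (xs : List Lat) : ℚ :=
  ∑ i ∈ Finset.range xs.length, (det (cyc xs i) (cyc xs (i + 1)) : ℚ) / (l : ℚ)

/-- `u` is the primitive outer normal of the segment `[x, y]`: it is primitive, and takes one and
the same positive value at `x` and at `y`. -/
def IsOuterNormal (u x y : Lat) : Prop :=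
  Primitive u ∧ pairing u x = pairing u y ∧ 0 < pairing u x

/-- The primitive outer normal of the segment `[x, y]`, where `y - x` is primitive and
`det x y ≠ 0`; see `isOuterNormal_iff`. -/
def outerNormal (x y : Lat) : Lat :=
  ((det x y).sign * (y.2 - x.2), (det x y).sign * (x.1 - y.1))

theorem isOuterNormal_iff {x y : Lat} (hp : Primitive (y - x)) (hd : det x y ≠ 0) (u : Lat) :
    IsOuterNormal u x y ↔ u = outerNormal x y := by
  obtain ⟨a, b⟩ := x
  obtain ⟨c, d⟩ := y
  obtain ⟨p, q⟩ := u
  simp only [IsOuterNormal, Primitive, pairing, outerNormal, det, Prod.fst_sub, Prod.snd_sub,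
    Prod.mk.injEq, ← Int.isCoprime_iff_gcd_eq_one] at *
  have key : ∀ s D : ℤ, D = a * d - b * c → (D = s * |D|) → s * s = 1 → D ≠ 0 →
      ((IsCoprime p q ∧ p * a + q * b = p * c + q * d ∧ 0 < p * a + q * b) ↔
        p = s * (d - b) ∧ q = s * (a - c)) := by
    intro s D hD hs hss hD0
    have hDpos : 0 < |D| := abs_pos.2 hD0
    constructor
    · rintro ⟨⟨e, f, hef⟩, h2, h3⟩
      obtain ⟨g, h, hgh⟩ := hp
      have h2' : p * (c - a) = -(q * (d - b)) := by linarith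
      obtain ⟨k, hk1, hk2⟩ : ∃ k : ℤ, p = k * (d - b) ∧ q = k * (a - c) := by
        refine ⟨p * h - q * g, ?_, ?_⟩
        · linear_combination (-p) * hgh + g * h2'
        · linear_combination (-q) * hgh + h * h2'
      have hku : k * (e * (d - b) + f * (a - c)) = 1 := by
        rw [hk1, hk2] at hef; linarith
      have hkD : 0 < (k * s) * |D| := by
        have : p * a + q * b = k * D := by rw [hk1, hk2, hD]; ring
        rw [this, hs] at h3; linarith
      have hks : 0 < k * s := (mul_pos_iff_of_pos_right hDpos).1 hkD
      have hk1' : k = 1 ∨ k = -1 := Int.isUnit_iff.1 (IsUnit.of_mul_eq_one _ hku)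
      have hs1 : s = 1 ∨ s = -1 := Int.isUnit_iff.1 (IsUnit.of_mul_eq_one _ hss)
      have : k = s := by
        rcases hk1' with h1 | h1 <;> rcases hs1 with h2 | h2 <;> rw [h1, h2] at hks ⊢ <;>
          norm_num at hks
      rw [← this]; exact ⟨hk1, hk2⟩
    · rintro ⟨rfl, rfl⟩
      obtain ⟨g, h, hgh⟩ := hp
      refine ⟨⟨s * h, -(s * g), ?_⟩, by ring, ?_⟩
      · linear_combination hss * (g * (c - a) + h * (d - b)) + hgh
      · have : s * (d - b) * a + s * (a - c) * b = |D| := by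
          calc _ = s * D := by rw [hD]; ring
            _ = (s * s) * |D| := by rw [mul_assoc, ← hs]
            _ = |D| := by rw [hss, one_mul]
        rw [this]; exact hDpos
  refine key _ _ rfl (Int.sign_mul_abs _).symm ?_ hd
  rcases lt_or_gt_of_ne hd with h | h
  · rw [Int.sign_eq_neg_one_of_neg h]; norm_num
  · rw [Int.sign_eq_one_of_pos h]; norm_num

/-- The lattice points of the segment `[a, b]` in their order from `a` (included) to `b`
(excluded). -/
def segmentPoints (a b : Lat) : List Lat :=
  (List.range (Int.gcd (b.1 - a.1) (b.2 - a.2))).map fun j =>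
    (a.1 + j * ((b.1 - a.1) / Int.gcd (b.1 - a.1) (b.2 - a.2)),
      a.2 + j * ((b.2 - a.2) / Int.gcd (b.1 - a.1) (b.2 - a.2)))

/-- The cyclic sequence of boundary lattice points of the dual loop `l P*`: the lattice points of
the segments `[uᵢ, uᵢ₊₁]`, run through in order, where `uᵢ` is the primitive outer normal of
`[xᵢ, xᵢ₊₁]`. -/
def dual (xs : List Lat) : List Lat :=
  (List.range xs.length).flatMap fun i =>
    segmentPoints (outerNormal (cyc xs i) (cyc xs (i + 1)))
      (outerNormal (cyc xs (i + 1)) (cyc xs (i + 2)))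

/-- The lattice point `x` as a complex number. -/
def toComplex (x : Lat) : ℂ := ⟨(x.1 : ℝ), (x.2 : ℝ)⟩

/-- The winding number around the origin of the closed polygon through the points `xs`: the total
change of the argument along the polygon, divided by `2π`. Along an edge `[x, y]` that does not
contain the origin the argument changes by the signed angle from `x` to `y`, which is
`arg (y / x) ∈ (-π, π)`. -/
noncomputable def windingNumber (xs : List Lat) : ℝ :=
  (∑ i ∈ Finset.range xs.length,
    Complex.arg (toComplex (cyc xs (i + 1)) / toComplex (cyc xs i))) / (2 * Real.pi)

end ReflexiveLoop

/-!
Suppose `x₁, …, xₜ` are the boundary points, with `det(xᵢ, xᵢ₊₁) = εᵢ l` for `εᵢ = ±1`. Reflexivity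
makes `cᵢ = det(xᵢ, xᵢ₊₂) / l` an integer, so that `εᵢ₊₁ xᵢ + εᵢ xᵢ₊₂ = cᵢ xᵢ₊₁`, and the lengths of
the loop and of its dual add up to `∑ (3 εᵢ - εᵢ εᵢ₊₁ cᵢ)`.

Following Poonen and Rodriguez-Villegas, this sum is computed with the Dedekind eta function. Read
`xᵢ` as a complex number and put `τᵢ = εᵢ xᵢ₊₁ / xᵢ`, a point of the upper half plane. The recursion
becomes `τᵢ₊₁ = -1 / τᵢ + εᵢ εᵢ₊₁ cᵢ`, and the translation and inversion laws of `log η` express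
`εᵢ εᵢ₊₁ cᵢ - 3 εᵢ + (6 / π) arg (xᵢ₊₁ / xᵢ)` as the difference of the values of
`(12 / π) Im (log η)` at `τᵢ₊₁` and `τᵢ`. Around a closed loop these differences cancel.
-/

section CyclicSums

theorem sum_range_succ_eq_of_apply_eq {M : Type*} [AddCommGroup M] {f : ℕ → M} {n : ℕ}
    (h : f n = f 0) : ∑ i ∈ Finset.range n, f (i + 1) = ∑ i ∈ Finset.range n, f i := by
  rw [← sub_eq_zero, ← Finset.sum_sub_distrib, Finset.sum_range_sub, h, sub_self]

theorem exists_int_sum_arg_div_eq {z : ℕ → ℂ} {n : ℕ} (hz : ∀ i, z i ≠ 0) (hn : z n = z 0) :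
    ∃ w : ℤ, ∑ i ∈ Finset.range n, Complex.arg (z (i + 1) / z i) = w * (2 * Real.pi) := by
  have hsum : ((∑ i ∈ Finset.range n, Complex.arg (z (i + 1) / z i) : ℝ) : Real.Angle) = 0 := by
    rw [← Real.Angle.coe_coeHom, map_sum]
    simp only [Real.Angle.coe_coeHom, Complex.arg_div_coe_angle (hz _) (hz _)]
    rw [Finset.sum_range_sub (fun i => (Complex.arg (z i) : Real.Angle)), hn, sub_self]
  obtain ⟨w, hw⟩ := Real.Angle.coe_eq_zero_iff.1 hsum
  exact ⟨w, by rw [← hw, zsmul_eq_mul]⟩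

end CyclicSums

section EtaPhase

open Complex hiding eta
open UpperHalfPlane hiding I im
open ModularForm

theorem continuousOn_tsum_log_one_sub_pow :
    ContinuousOn (fun q : ℂ => ∑' n : ℕ, log (1 - q ^ (n + 1))) (Metric.ball 0 1) := by
  intro q₀ hq₀
  obtain ⟨r, hr₀, hr₁⟩ := exists_between (mem_ball_zero_iff.1 hq₀)
  have hr : 0 ≤ r := (norm_nonneg q₀).trans hr₀.le
  have hbound (n : ℕ) (q : ℂ) (hq : q ∈ Metric.ball 0 r) : ‖-q ^ (n + 1)‖ ≤ r ^ (n + 1) := by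
    rw [norm_neg, norm_pow]
    exact pow_le_pow_left₀ (norm_nonneg q) (mem_ball_zero_iff.1 hq).le _
  have hlim := ((summable_nat_add_iff 1).2
    (summable_geometric_of_lt_one hr hr₁)).tendstoUniformlyOn_tsum_nat_log_one_add
      (Filter.Eventually.of_forall hbound)
  have hterm (n : ℕ) : ContinuousOn (fun q : ℂ => log (1 + -q ^ (n + 1))) (Metric.ball 0 r) :=
    ContinuousOn.clog (by fun_prop) fun q hq =>
      mem_slitPlane_of_norm_lt_one ((hbound n q hq).trans_lt (pow_lt_one₀ hr hr₁ n.succ_ne_zero))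
  have hcont := hlim.continuousOn
    (Filter.Frequently.of_forall fun n => continuousOn_finsetSum _ fun i _ => hterm i)
  simp only [← sub_eq_add_neg] at hcont
  exact (hcont.continuousAt (Metric.isOpen_ball.mem_nhds
    (mem_ball_zero_iff.2 hr₀))).continuousWithinAt

/-- The logarithm of the Dedekind eta function on the upper half plane that adds up the principal
logarithms of the factors of its product expansion. -/
noncomputable def logEta (z : ℂ) : ℂ :=
  2 * Real.pi * I / 24 * z + ∑' n, log (1 - eta_q n z)

theorem continuousOn_logEta : ContinuousOn logEta upperHalfPlaneSet := by
  have hq : Set.MapsTo (Function.Periodic.qParam 1) upperHalfPlaneSet (Metric.ball (0 : ℂ) 1) :=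
    fun z hz => by simpa using norm_qParam_lt_one 1 ⟨z, hz⟩
  exact ContinuousOn.add (by fun_prop) (continuousOn_tsum_log_one_sub_pow.comp (by fun_prop) hq)

theorem exp_logEta {z : ℂ} (hz : z ∈ upperHalfPlaneSet) : exp (logEta z) = eta z := by
  have hsum : Summable fun n => log (1 - eta_q n z) := by
    simpa only [sub_eq_add_neg] using
      summable_log_one_add_of_summable (summable_eta_q ⟨z, hz⟩).of_norm
  rw [logEta, exp_add, cexp_tsum_eq_tprod (fun n => one_sub_eta_q_ne_zero n hz) hsum, eta,
    Function.Periodic.qParam]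
  push_cast
  ring_nf

theorem logEta_add_intCast (z : ℂ) (a : ℤ) :
    logEta (z + a) = logEta z + 2 * Real.pi * I / 24 * a := by
  have hq : Function.Periodic.qParam 1 (z + a) = Function.Periodic.qParam 1 z := by
    simp only [Function.Periodic.qParam]
    exact exp_eq_exp_iff_exists_int.2 ⟨a, by push_cast; ring⟩
  simp only [logEta, eta_q, hq]
  ring

theorem neg_one_div_mem_upperHalfPlaneSet {z : ℂ} (hz : z ∈ upperHalfPlaneSet) :
    -1 / z ∈ upperHalfPlaneSet := by
  simpa [neg_div, inv_neg] using im_inv_neg_coe_pos ⟨z, hz⟩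

theorem logEta_neg_one_div {z : ℂ} (hz : z ∈ upperHalfPlaneSet) :
    logEta (-1 / z) = logEta z + (log z - log I) / 2 := by
  have hne : ∀ w ∈ upperHalfPlaneSet, w ≠ 0 := fun w hw => ne_zero (⟨w, hw⟩ : ℍ)
  have hinv : ContinuousOn (fun w : ℂ => -1 / w) upperHalfPlaneSet :=
    continuousOn_const.div continuousOn_id hne
  have hleft : ContinuousOn (fun w => logEta (-1 / w)) upperHalfPlaneSet :=
    continuousOn_logEta.comp hinv fun _ => neg_one_div_mem_upperHalfPlaneSet
  have hright : ContinuousOn (fun w => logEta w + (log w - log I) / 2) upperHalfPlaneSet :=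
    continuousOn_logEta.add (((continuousOn_id.clog fun w hw =>
      mem_slitPlane ⟨w, hw⟩).sub continuousOn_const).div_const 2)
  have hexp : ∀ w ∈ upperHalfPlaneSet,
      exp (logEta (-1 / w)) = exp (logEta w + (log w - log I) / 2) := by
    intro w hw
    have hS : eta (-1 / w) = (sqrt I)⁻¹ * (sqrt w * eta w) := eta_comp_eq_csqrt_I_inv hw
    rw [exp_logEta (neg_one_div_mem_upperHalfPlaneSet hw), hS, ← exp_logEta hw,
      sqrt_eq_exp I_ne_zero, sqrt_eq_exp (hne w hw), ← exp_neg, ← exp_add, ← exp_add]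
    ring_nf
  -- Two continuous lifts through the covering map `exp` that agree at the fixed point `I`.
  exact isCoveringMap_exp.eqOn_of_comp_eqOn (convex_halfSpace_im_gt 0).isPreconnected hleft hright
    (fun w hw => Subtype.ext (hexp w hw)) (a := I) (by simp) (by simp) hz

/-- The argument of the Dedekind eta function, scaled so that translation by an integer `a`
increases it by `a`. -/
noncomputable def etaPhase (z : ℂ) : ℝ := 12 / Real.pi * (logEta z).im

theorem etaPhase_add_intCast (z : ℂ) (a : ℤ) : etaPhase (z + a) = etaPhase z + a := by
  have him : (2 * (Real.pi : ℂ) * I / 24 * a).im = Real.pi / 12 * a := by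
    rw [show 2 * (Real.pi : ℂ) * I / 24 * a = ((Real.pi / 12 * a : ℝ) : ℂ) * I by push_cast; ring,
      im_ofReal_mul, Complex.I_im, mul_one]
  rw [etaPhase, etaPhase, logEta_add_intCast, add_im, him]
  field_simp

theorem etaPhase_neg_one_div {z : ℂ} (hz : 0 < z.im) :
    etaPhase (-1 / z) = etaPhase z + 6 / Real.pi * arg z - 3 := by
  have him : ((log z - log I) / 2).im = (arg z - Real.pi / 2) / 2 := by
    rw [div_ofNat_im, sub_im, log_im, log_im, arg_I]
  rw [etaPhase, etaPhase, logEta_neg_one_div hz, add_im, him]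
  field_simp
  ring

theorem arg_sign_mul {e : ℤ} (he : e = 1 ∨ e = -1) {z : ℂ} (hz : 0 < e * z.im) :
    arg (e * z) = arg z + (1 - e) * (Real.pi / 2) := by
  rcases he with rfl | rfl
  · simp
  · have him : z.im < 0 := by simpa using hz
    push_cast
    rw [neg_one_mul, arg_neg_eq_arg_add_pi_of_im_neg him]
    ring

theorem etaPhase_sign_mul_div {x y z : ℂ} {e f c : ℤ} (he : e = 1 ∨ e = -1) (hf : f = 1 ∨ f = -1)
    (hxy : 0 < e * (y / x).im) (hrec : f * x + e * z = c * y) :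
    etaPhase (f * (z / y)) =
      etaPhase (e * (y / x)) + (e * f * c : ℤ) + 6 / Real.pi * arg (y / x) - 3 * e := by
  have hy : y ≠ 0 := by rintro rfl; simp at hxy
  have he₀ : (e : ℂ) ≠ 0 := by rcases he with rfl | rfl <;> norm_num
  have hee : (e : ℂ) * e = 1 := by rcases he with rfl | rfl <;> norm_num
  have hff : (f : ℂ) * f = 1 := by rcases hf with rfl | rfl <;> norm_num
  have hτ : (f : ℂ) * (z / y) = -1 / (e * (y / x)) + (e * f * c : ℤ) := by
    push_cast
    field_simp
    linear_combination (f : ℂ) * hrec - f * c * y * hee - x * hff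
  have him : 0 < ((e : ℂ) * (y / x)).im := by simpa using hxy
  rw [hτ, etaPhase_add_intCast, etaPhase_neg_one_div him, arg_sign_mul he hxy]
  field_simp
  ring

theorem six_div_pi_mul_sum_arg_div_eq {z : ℕ → ℂ} {e c : ℕ → ℤ} {n : ℕ}
    (hz : Function.Periodic z n) (hen : e n = e 0) (he : ∀ i, e i = 1 ∨ e i = -1)
    (hpos : ∀ i, 0 < e i * (z (i + 1) / z i).im)
    (hrec : ∀ i, e (i + 1) * z i + e i * z (i + 2) = c i * z (i + 1)) :
    6 / Real.pi * ∑ i ∈ Finset.range n, arg (z (i + 1) / z i) =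
      (∑ i ∈ Finset.range n, (3 * e i - e i * e (i + 1) * c i) : ℤ) := by
  let phase (i : ℕ) : ℝ := etaPhase (e i * (z (i + 1) / z i))
  have hstep (i : ℕ) : 6 / Real.pi * arg (z (i + 1) / z i) =
      phase (i + 1) - phase i + (3 * e i - e i * e (i + 1) * c i : ℤ) := by
    have := etaPhase_sign_mul_div (he i) (he (i + 1)) (hpos i) (hrec i)
    simp only [phase]
    push_cast at this ⊢
    linarith
  have hclosed : phase n = phase 0 := by
    simp only [phase, hen, add_comm n 1, hz 1, hz.eq, zero_add]
  rw [Finset.mul_sum, Finset.sum_congr rfl fun i _ => hstep i, Finset.sum_add_distrib,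
    Finset.sum_range_sub, hclosed, sub_self, zero_add, Int.cast_sum]

end EtaPhase

namespace ReflexiveLoop

section Lattice

variable {l : ℤ} {x y z : Lat}

theorem Primitive.eq_or_eq_neg_of_det_eq_zero (hx : Primitive x) (hy : Primitive y)
    (h : det x y = 0) : y = x ∨ y = -x := by
  simp only [Primitive, det, ← Int.isCoprime_iff_gcd_eq_one] at hx hy h
  obtain ⟨g, k, hgk⟩ := hx
  obtain ⟨p, q, hpq⟩ := hy
  have hfst : y.1 = (g * y.1 + k * y.2) * x.1 := by linear_combination (-y.1) * hgk - k * h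
  have hsnd : y.2 = (g * y.1 + k * y.2) * x.2 := by linear_combination (-y.2) * hgk + g * h
  have hunit : (g * y.1 + k * y.2) * (p * x.1 + q * x.2) = 1 := by
    linear_combination hpq - p * hfst - q * hsnd
  rcases Int.isUnit_iff.1 (IsUnit.of_mul_eq_one _ hunit) with hm | hm <;> rw [hm] at hfst hsnd
  · exact Or.inl (Prod.ext (by simpa using hfst) (by simpa using hsnd))
  · exact Or.inr (Prod.ext (by simpa using hfst) (by simpa using hsnd))

theorem det_sub_sub_eq_zero_of_mem_segment (h : toRat y ∈ segment ℚ (toRat x) (toRat z)) :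
    det (y - x) (z - y) = 0 := by
  obtain ⟨s, t, -, -, hst, h⟩ := h
  simp only [toRat, Prod.smul_mk, Prod.mk_add_mk, smul_eq_mul, Prod.mk.injEq] at h
  obtain rfl : s = 1 - t := by linarith
  have hdet : (det (y - x) (z - y) : ℚ) = 0 := by
    simp only [det, Prod.fst_sub, Prod.snd_sub]
    push_cast
    rw [← h.1, ← h.2]
    ring
  exact_mod_cast hdet

theorem toRat_injective : Function.Injective toRat := fun x y h => by
  simpa [toRat, Prod.ext_iff] using h

theorem sub_eq_sub_of_mem_segment (hxy : Primitive (y - x)) (hyz : Primitive (z - y))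
    (h : toRat y ∈ segment ℚ (toRat x) (toRat z)) : z - y = y - x := by
  rcases hxy.eq_or_eq_neg_of_det_eq_zero hyz (det_sub_sub_eq_zero_of_mem_segment h) with hz | hz
  · exact hz
  · obtain rfl : z = x := by simpa using hz
    rw [segment_same, Set.mem_singleton_iff] at h
    obtain rfl := toRat_injective h
    simp [Primitive] at hxy

theorem det_smul_add_det_smul (x y z : Lat) :
    det y z • x + det x y • z = det x z • y := by
  ext <;> simp only [det, Prod.fst_add, Prod.snd_add, Prod.smul_fst, Prod.smul_snd, smul_eq_mul] <;>
    ring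

theorem Primitive.dvd_det (hy : Primitive y) (hxy : l ∣ det x y) (hyz : l ∣ det y z) :
    l ∣ det x z := by
  obtain ⟨g, k, hgk⟩ := Int.isCoprime_iff_gcd_eq_one.2 hy
  have hdet : det x z = det y z * (g * x.1 + k * x.2) + det x y * (g * z.1 + k * z.2) := by
    simp only [det]
    linear_combination (-(x.1 * z.2 - x.2 * z.1)) * hgk
  rw [hdet]
  exact dvd_add (hyz.mul_right _) (hxy.mul_right _)

theorem dvd_det_of_primitive_vertex (hxy : l ∣ det x y) (hyz : l ∣ det y z)
    (hx : Primitive (y - x)) (hz : Primitive (z - y))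
    (hy : toRat y ∉ segment ℚ (toRat x) (toRat z) → Primitive y) : l ∣ det x z := by
  by_cases hmem : toRat y ∈ segment ℚ (toRat x) (toRat z)
  · obtain rfl : z = y - x + y := sub_eq_iff_eq_add.1 (sub_eq_sub_of_mem_segment hx hz hmem)
    have hdet : det x (y - x + y) = 2 * det x y := by
      simp only [det, Prod.fst_add, Prod.snd_add, Prod.fst_sub, Prod.snd_sub]
      ring
    exact hdet ▸ hxy.mul_left 2
  · exact (hy hmem).dvd_det hxy hyz

theorem det_outerNormal (x y z : Lat) :
    det (outerNormal x y) (outerNormal y z) =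
      (det x y).sign * (det y z).sign * (det x y + det y z - det x z) := by
  simp only [outerNormal, det]
  ring

end Lattice

section PathDeterminant

/-- The sum of the determinants of consecutive points on the path that runs through `ys` and ends
at `b`. A closed path through `ys` has `b` equal to the head of `ys`. -/
def pathDet (ys : List Lat) (b : Lat) : ℤ :=
  ∑ i ∈ Finset.range ys.length, det (ys.getD i b) (ys.getD (i + 1) b)

theorem pathDet_cons (y : Lat) (ys : List Lat) (b : Lat) :
    pathDet (y :: ys) b = det y (ys.getD 0 b) + pathDet ys b := by
  simp [pathDet, Finset.sum_range_succ', add_comm]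

theorem getD_zero_append (ys zs : List Lat) (b : Lat) :
    (ys ++ zs).getD 0 b = ys.getD 0 (zs.getD 0 b) := by
  cases ys <;> simp

theorem pathDet_append (ys zs : List Lat) (b : Lat) :
    pathDet (ys ++ zs) b = pathDet ys (zs.getD 0 b) + pathDet zs b := by
  induction ys with
  | nil => simp [pathDet]
  | cons y ys ih =>
    rw [List.cons_append, pathDet_cons, pathDet_cons, ih, getD_zero_append, add_assoc]

theorem cyc_eq_getD {ys : List Lat} {b : Lat} (hys : ys ≠ []) (h : ys.getD 0 b = b) {i : ℕ}
    (hi : i ≤ ys.length) : cyc ys i = ys.getD i b := by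
  rcases hi.lt_or_eq with hi | rfl
  · simp [cyc, Nat.mod_eq_of_lt hi, hi]
  · cases ys <;> simp_all [cyc]

theorem length_eq_pathDet_div (l : ℕ) {ys : List Lat} {b : Lat} (h : ys.getD 0 b = b) :
    length l ys = pathDet ys b / (l : ℚ) := by
  rw [length, pathDet, ← Finset.sum_div, Int.cast_sum]
  congr 1
  refine Finset.sum_congr rfl fun i hi => ?_
  have hi := Finset.mem_range.1 hi
  have hys : ys ≠ [] := List.length_pos_iff.1 (Nat.zero_lt_of_lt hi)
  rw [cyc_eq_getD hys h hi.le, cyc_eq_getD hys h hi]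

theorem getD_segmentPoints (a b : Lat) {j : ℕ} (hj : j ≤ Int.gcd (b.1 - a.1) (b.2 - a.2)) :
    (segmentPoints a b).getD j b =
      (a.1 + j * ((b.1 - a.1) / Int.gcd (b.1 - a.1) (b.2 - a.2)),
        a.2 + j * ((b.2 - a.2) / Int.gcd (b.1 - a.1) (b.2 - a.2))) := by
  rcases hj.lt_or_eq with hj | rfl
  · rw [List.getD_eq_getElem _ _ (by simpa [segmentPoints] using hj)]
    simp [segmentPoints, ← List.map_eq_flatMap]
  · rw [List.getD_eq_default _ _ (by simp [segmentPoints]),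
      Int.mul_ediv_cancel' (Int.gcd_dvd_left ..), Int.mul_ediv_cancel' (Int.gcd_dvd_right ..)]
    simp

theorem getD_zero_segmentPoints (a b : Lat) : (segmentPoints a b).getD 0 b = a := by
  rw [getD_segmentPoints a b (Nat.zero_le _)]
  simp

theorem pathDet_segmentPoints (a b : Lat) : pathDet (segmentPoints a b) b = det a b := by
  set g := Int.gcd (b.1 - a.1) (b.2 - a.2) with hg
  have hfst : (g : ℤ) * ((b.1 - a.1) / g) = b.1 - a.1 := Int.mul_ediv_cancel' (Int.gcd_dvd_left ..)
  have hsnd : (g : ℤ) * ((b.2 - a.2) / g) = b.2 - a.2 := Int.mul_ediv_cancel' (Int.gcd_dvd_right ..)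
  have hlength : (segmentPoints a b).length = g := by simp [segmentPoints, hg]
  have hterm : ∀ j ∈ Finset.range g,
      det ((segmentPoints a b).getD j b) ((segmentPoints a b).getD (j + 1) b) =
        a.1 * ((b.2 - a.2) / g) - a.2 * ((b.1 - a.1) / g) := by
    intro j hj
    have hj := Finset.mem_range.1 hj
    rw [getD_segmentPoints a b hj.le, getD_segmentPoints a b hj]
    simp only [det]
    push_cast
    ring
  rw [pathDet, hlength, Finset.sum_congr rfl hterm, Finset.sum_const, Finset.card_range,
    nsmul_eq_mul, det]
  linear_combination a.1 * hsnd - a.2 * hfst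

theorem getD_zero_flatMap_segmentPoints (u : ℕ → Lat) (n : ℕ) :
    ((List.range n).flatMap fun i => segmentPoints (u i) (u (i + 1))).getD 0 (u n) = u 0 := by
  induction n with
  | zero => simp
  | succ n ih =>
    rw [List.range_succ, List.flatMap_append, List.flatMap_singleton, getD_zero_append,
      getD_zero_segmentPoints, ih]

theorem pathDet_flatMap_segmentPoints (u : ℕ → Lat) (n : ℕ) :
    pathDet ((List.range n).flatMap fun i => segmentPoints (u i) (u (i + 1))) (u n) =
      ∑ i ∈ Finset.range n, det (u i) (u (i + 1)) := by
  induction n with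
  | zero => simp [pathDet]
  | succ n ih =>
    rw [List.range_succ, List.flatMap_append, List.flatMap_singleton, pathDet_append,
      getD_zero_segmentPoints, ih, pathDet_segmentPoints, Finset.sum_range_succ]

theorem periodic_cyc (xs : List Lat) : Function.Periodic (cyc xs) xs.length := fun i => by
  simp [cyc]

theorem periodic_cyc_edge {α : Type*} (F : Lat → Lat → α) (xs : List Lat) :
    Function.Periodic (fun i => F (cyc xs i) (cyc xs (i + 1))) xs.length := fun i => by
  simp only [add_right_comm i xs.length 1, periodic_cyc xs _]

theorem length_dual (l : ℕ) (xs : List Lat) :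
    length l (dual xs) = ∑ i ∈ Finset.range xs.length,
      (det (outerNormal (cyc xs i) (cyc xs (i + 1)))
        (outerNormal (cyc xs (i + 1)) (cyc xs (i + 2))) : ℚ) / (l : ℚ) := by
  let u (i : ℕ) : Lat := outerNormal (cyc xs i) (cyc xs (i + 1))
  have hu : u xs.length = u 0 := (periodic_cyc_edge outerNormal xs).eq
  have hclosed : (dual xs).getD 0 (u xs.length) = u xs.length :=
    (getD_zero_flatMap_segmentPoints u xs.length).trans hu.symm
  have hdet : pathDet (dual xs) (u xs.length) =
      ∑ i ∈ Finset.range xs.length, det (u i) (u (i + 1)) :=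
    pathDet_flatMap_segmentPoints u xs.length
  rw [length_eq_pathDet_div l hclosed, hdet, ← Finset.sum_div, Int.cast_sum]

end PathDeterminant

section ComplexPolygon

theorem toComplex_add (x y : Lat) : toComplex (x + y) = toComplex x + toComplex y := by
  apply Complex.ext <;> simp [toComplex]

theorem toComplex_zsmul (n : ℤ) (x : Lat) : toComplex (n • x) = n * toComplex x := by
  apply Complex.ext <;> simp [toComplex]

theorem toComplex_ne_zero {x : Lat} (hx : x ≠ 0) : toComplex x ≠ 0 := by
  simpa [toComplex, Complex.ext_iff, Prod.ext_iff] using hx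

theorem im_toComplex_div (x y : Lat) :
    (toComplex y / toComplex x).im = det x y / Complex.normSq (toComplex x) := by
  simp only [Complex.div_im, toComplex, det]
  push_cast
  ring

theorem periodic_toComplex_cyc (xs : List Lat) :
    Function.Periodic (fun i => toComplex (cyc xs i)) xs.length :=
  (periodic_cyc xs).comp toComplex

theorem windingNumber_mul_two_pi (xs : List Lat) :
    windingNumber xs * (2 * Real.pi) = ∑ i ∈ Finset.range xs.length,
      Complex.arg (toComplex (cyc xs (i + 1)) / toComplex (cyc xs i)) :=
  div_mul_cancel₀ _ Real.two_pi_pos.ne'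

theorem exists_windingNumber_eq_intCast {xs : List Lat} (hxs : ∀ i, cyc xs i ≠ 0) :
    ∃ w : ℤ, windingNumber xs = w := by
  obtain ⟨w, hw⟩ := exists_int_sum_arg_div_eq (fun i => toComplex_ne_zero (hxs i))
    (periodic_toComplex_cyc xs).eq
  rw [← windingNumber_mul_two_pi] at hw
  exact ⟨w, mul_right_cancel₀ Real.two_pi_pos.ne' hw⟩

end ComplexPolygon

section ReflexiveLoops

/-- The orientation `±1` of the edge `[xᵢ, xᵢ₊₁]` as seen from the origin. -/
def edgeSign (xs : List Lat) (i : ℕ) : ℤ := (det (cyc xs i) (cyc xs (i + 1))).sign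

/-- The coefficient `cᵢ` of the recursion `εᵢ₊₁ xᵢ + εᵢ xᵢ₊₂ = cᵢ xᵢ₊₁` along an `l`-reflexive
loop, on which the division by `l` is exact. -/
def recursionCoeff (l : ℕ) (xs : List Lat) (i : ℕ) : ℤ := det (cyc xs i) (cyc xs (i + 2)) / l

theorem edgeSign_length (xs : List Lat) : edgeSign xs xs.length = edgeSign xs 0 :=
  (periodic_cyc_edge (fun x y => (det x y).sign) xs).eq

namespace IsReflexiveLoop

variable {l : ℕ} {xs : List Lat} (hP : IsReflexiveLoop l xs)

include hP

theorem natCast_ne_zero : (l : ℤ) ≠ 0 := by exact_mod_cast hP.index_pos.ne'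

theorem edgeSign_eq_one_or_neg_one (i : ℕ) : edgeSign xs i = 1 ∨ edgeSign xs i = -1 := by
  have hl : (l : ℤ).sign = 1 := Int.sign_eq_one_of_pos (by exact_mod_cast hP.index_pos)
  rcases hP.det_eq i with h | h <;> simp [edgeSign, h, hl]

theorem edgeSign_mul_self (i : ℕ) : edgeSign xs i * edgeSign xs i = 1 := by
  rcases hP.edgeSign_eq_one_or_neg_one i with h | h <;> simp [h]

theorem det_eq_edgeSign_mul (i : ℕ) :
    det (cyc xs i) (cyc xs (i + 1)) = edgeSign xs i * l := by
  have habs : |det (cyc xs i) (cyc xs (i + 1))| = l := by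
    rcases hP.det_eq i with h | h <;> simp [h]
  rw [edgeSign, ← habs, Int.sign_mul_abs]

theorem det_eq_recursionCoeff_mul (i : ℕ) :
    det (cyc xs i) (cyc xs (i + 2)) = recursionCoeff l xs i * l :=
  (Int.ediv_mul_cancel (dvd_det_of_primitive_vertex
    (Dvd.intro_left _ (hP.det_eq_edgeSign_mul i).symm)
    (Dvd.intro_left _ (hP.det_eq_edgeSign_mul (i + 1)).symm)
    (hP.primitive_step i) (hP.primitive_step (i + 1)) (hP.primitive_vertex i))).symm

theorem edgeSign_smul_add_edgeSign_smul (i : ℕ) :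
    edgeSign xs (i + 1) • cyc xs i + edgeSign xs i • cyc xs (i + 2) =
      recursionCoeff l xs i • cyc xs (i + 1) := by
  have h := det_smul_add_det_smul (cyc xs i) (cyc xs (i + 1)) (cyc xs (i + 2))
  rw [hP.det_eq_edgeSign_mul i, hP.det_eq_edgeSign_mul (i + 1), hP.det_eq_recursionCoeff_mul i,
    mul_comm _ (l : ℤ), mul_comm _ (l : ℤ), mul_comm _ (l : ℤ), mul_smul, mul_smul, mul_smul,
    ← smul_add] at h
  exact smul_right_injective Lat hP.natCast_ne_zero h

theorem length_eq_sum_edgeSign :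
    length l xs = (∑ i ∈ Finset.range xs.length, edgeSign xs i : ℤ) := by
  rw [length, Int.cast_sum]
  refine Finset.sum_congr rfl fun i _ => ?_
  rw [hP.det_eq_edgeSign_mul, div_eq_iff (by exact_mod_cast hP.natCast_ne_zero)]
  push_cast
  rfl

theorem det_outerNormal_eq (i : ℕ) :
    det (outerNormal (cyc xs i) (cyc xs (i + 1)))
        (outerNormal (cyc xs (i + 1)) (cyc xs (i + 2))) =
      (edgeSign xs i + edgeSign xs (i + 1) -
        edgeSign xs i * edgeSign xs (i + 1) * recursionCoeff l xs i) * l := by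
  have hdet : det (outerNormal (cyc xs i) (cyc xs (i + 1)))
      (outerNormal (cyc xs (i + 1)) (cyc xs (i + 2))) =
        edgeSign xs i * edgeSign xs (i + 1) * (edgeSign xs i * l + edgeSign xs (i + 1) * l -
          recursionCoeff l xs i * l) := by
    rw [← hP.det_eq_edgeSign_mul i, ← hP.det_eq_edgeSign_mul (i + 1),
      ← hP.det_eq_recursionCoeff_mul i]
    exact det_outerNormal ..
  rw [hdet]
  linear_combination (edgeSign xs (i + 1) * l) * hP.edgeSign_mul_self i +
    (edgeSign xs i * l) * hP.edgeSign_mul_self (i + 1)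

theorem length_dual_eq_sum : length l (dual xs) = (∑ i ∈ Finset.range xs.length,
    (edgeSign xs i + edgeSign xs (i + 1) -
      edgeSign xs i * edgeSign xs (i + 1) * recursionCoeff l xs i) : ℤ) := by
  rw [length_dual, Int.cast_sum]
  refine Finset.sum_congr rfl fun i _ => ?_
  rw [hP.det_outerNormal_eq, div_eq_iff (by exact_mod_cast hP.natCast_ne_zero)]
  push_cast
  rfl

theorem length_add_length_dual : length l xs + length l (dual xs) =
    (∑ i ∈ Finset.range xs.length,
      (3 * edgeSign xs i - edgeSign xs i * edgeSign xs (i + 1) * recursionCoeff l xs i) : ℤ) := by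
  rw [hP.length_eq_sum_edgeSign, hP.length_dual_eq_sum, ← Int.cast_add]
  simp only [Finset.sum_sub_distrib, Finset.sum_add_distrib, ← Finset.mul_sum,
    sum_range_succ_eq_of_apply_eq (edgeSign_length xs)]
  ring_nf

theorem edgeSign_mul_im_div_pos (i : ℕ) :
    0 < edgeSign xs i * (toComplex (cyc xs (i + 1)) / toComplex (cyc xs i)).im := by
  have hdet : edgeSign xs i * det (cyc xs i) (cyc xs (i + 1)) = l := by
    rw [hP.det_eq_edgeSign_mul, ← mul_assoc, hP.edgeSign_mul_self, one_mul]
  have hl : (0 : ℝ) < edgeSign xs i * det (cyc xs i) (cyc xs (i + 1)) := by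
    exact_mod_cast hdet ▸ Int.natCast_pos.2 hP.index_pos
  rw [im_toComplex_div, ← mul_div_assoc]
  exact div_pos hl (Complex.normSq_pos.2 (toComplex_ne_zero (hP.ne_zero i)))

theorem twelve_mul_windingNumber : 12 * windingNumber xs =
    (∑ i ∈ Finset.range xs.length,
      (3 * edgeSign xs i - edgeSign xs i * edgeSign xs (i + 1) * recursionCoeff l xs i) : ℤ) := by
  have hrec (i : ℕ) : (edgeSign xs (i + 1) : ℂ) * toComplex (cyc xs i) +
      edgeSign xs i * toComplex (cyc xs (i + 2)) =
        recursionCoeff l xs i * toComplex (cyc xs (i + 1)) := by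
    simp only [← toComplex_zsmul, ← toComplex_add, hP.edgeSign_smul_add_edgeSign_smul i]
  rw [← six_div_pi_mul_sum_arg_div_eq (periodic_toComplex_cyc xs) (edgeSign_length xs)
    hP.edgeSign_eq_one_or_neg_one hP.edgeSign_mul_im_div_pos hrec, ← windingNumber_mul_two_pi]
  field_simp
  ring

end IsReflexiveLoop

end ReflexiveLoops

end ReflexiveLoop

theorem mainTheorem5 (l : ℕ) (xs : List ReflexiveLoop.Lat)
    (hP : ReflexiveLoop.IsReflexiveLoop l xs) :
    ∃ w : ℤ, ReflexiveLoop.windingNumber xs = (w : ℝ) ∧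
      ReflexiveLoop.length l xs + ReflexiveLoop.length l (ReflexiveLoop.dual xs)
        = 12 * (w : ℚ) := by
  obtain ⟨w, hw⟩ := ReflexiveLoop.exists_windingNumber_eq_intCast hP.ne_zero
  have htwelve := hP.twelve_mul_windingNumber
  rw [hw] at htwelve
  refine ⟨w, hw, ?_⟩
  rw [hP.length_add_length_dual]
  exact_mod_cast htwelve.symm
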